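/- Let $p>1$ and let $\mu$ be a Borel probability measure on $\mathbb{R}^2$ with $\int|x|^p\,\mu(\mathrm{d}x)<\infty$, where $|\cdot|$ is the Euclidean norm. Write $X=(X_1,X_2)$ for the identity map of $\mathbb{R}^2$, $\mu_1,\mu_2$ for the marginals of $\mu$, and $\mathbb{E}^\mu_i[u]:=\mathbb{E}^\mu[u(X)\mid X_i]$. Let $\Pi(\mu_1,\mu_2)$ be the set of probability measures on $\mathbb{R}^2$ with marginals $\mu_1,\mu_2$, and for $T:\mathbb{R}^2\to\mathbb{R}^2$ let $\mu^{T}:=\mu\circ(X+T)^{-1}$. Let $\mathbb{W}_p(\nu,\nu'):=\inf_\pi \mathbb{E}^\pi[|X-X'|^p]^{1/p}$, the infimum being over all couplings $\pi$ (laws of pairs $(X,X')$ on $\mathbb{R}^2\times\mathbb{R}^2$) of $\nu$ and $\nu'$. Let $\mathbb{W}_p^{\rm ad}(\nu,\nu')$ be the same infimum over bicausal couplings, i.e. those under which $X$ and $X_1'$ are conditionally independent given $X_1$, and $X'$ and $X_1$ are conditionally independent given $X_1'$. For a set $U$ of probability measures put $\mathbf{d}(\nu,U):=\inf_{\nu'\in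 U}\mathbf{d}(\nu,\nu')$. Consider the following assumptions. - $\mathbf{B}_{\mathbb{W}_p}$: $\mu$ has a density with respect to Lebesgue measure on $\mathbb{R}^2$; for $i=1,2$, $\mu_i(\mathrm{d}x)=q_i(x)\mathbf{1}_{\{x\in I_i\}}\mathrm{d}x$ with $I_i$ an interval and $q_i:I_i\to[0,\infty)$ continuous; and $\mu(\mathrm{d}x)=k(x_1,x_2)\,\mathrm{d}x_2\,\mu_1(\mathrm{d}x_1)$ with $k$ bounded. - $\mathbf{B}_{\mathbb{W}_p^{\rm ad}}$: $\mu(\mathrm{d}x)=\kappa(x_1,x_2)\,\mathrm{d}x_2\,\mu_1(\mathrm{d}x_1)$ with $\kappa$ bounded; and $\mu_2(\mathrm{d}x)=q_2(x)\mathbf{1}_{\{x\in I_2\}}\mathrm{d}x$ with $I_2$ an interval and $q_2:I_2\to[0,\infty)$ continuous. Let $\mathbf{d}\in\{\mathbb{W}_p,\mathbb{W}_p^{\rm ad}\}$ and assume $\mathbf{B}_{\mathbf{d}}$. Then there is a constant $C>0$ such that, for every compactly supported $C^2$ map $\Theta=(\Theta_1,\Theta_2):\mathbb{R}^2\to\mathbb{R}^2$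 satisfying - if $\mathbf{d}=\mathbb{W}_p$: $\operatorname{supp}\Theta\subset M_1\times M_2$ for some $M_1\subsetneq I_1$ and $M_2\subsetneq I_2$; - if $\mathbf{d}=\mathbb{W}_p^{\rm ad}$: $\Theta_1=0$ and $\operatorname{supp}\Theta\subset \mathbb{R}\times M_2$ for some $M_2\subsetneq I_2$, one has $$\limsup_{r\downarrow 0}\frac1r\,\mathbf{d}\big(\mu^{r\Theta},\Pi(\mu_1,\mu_2)\big)\le C\,\Big(\big\|\mathbb{E}^\mu_1[\Theta_1]\big\|_{\mathbb{L}^p(\mu)}+\big\|\mathbb{E}^\mu_2[\Theta_2]\big\|_{\mathbb{L}^p(\mu)}\Big).$$ -/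

import Mathlib

open MeasureTheory Filter Topology
open scoped ENNReal

namespace CouplingProj

/-- The set of probability measures on `α × β` with marginals `μ` and `ν`. -/
def couplings {α β : Type*} [MeasurableSpace α] [MeasurableSpace β]
    (μ : Measure α) (ν : Measure β) : Set (Measure (α × β)) :=
  {π | IsProbabilityMeasure π ∧ π.map Prod.fst = μ ∧ π.map Prod.snd = ν}

/-- The Euclidean distance on the plane (the distance of `ℝ × ℝ` in Mathlib is the sup distance). -/
noncomputable def euclDist (x y : ℝ × ℝ) : ℝ :=
  √((x.1 - y.1) ^ 2 + (x.2 - y.2) ^ 2)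

/-- A law of `(X, X')`, with `X = (X₁, X₂)` and `X' = (X'₁, X'₂)`, is causal if `X` and `X'₁` are
conditionally independent given `X₁`, expressed through bounded Borel functions. -/
def IsCausal (π : Measure ((ℝ × ℝ) × (ℝ × ℝ))) : Prop :=
  ∀ (f : ℝ × ℝ → ℝ) (g : ℝ → ℝ), Measurable f → Measurable g →
    (∃ c, ∀ x, |f x| ≤ c) → (∃ c, ∀ x, |g x| ≤ c) →
    π[fun z => f z.1 * g z.2.1 | MeasurableSpace.comap (fun z => z.1.1) inferInstance]
      =ᵐ[π]
    π[fun z => f z.1 | MeasurableSpace.comap (fun z => z.1.1) inferInstance] *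
      π[fun z => g z.2.1 | MeasurableSpace.comap (fun z => z.1.1) inferInstance]

/-- The couplings that are causal in both directions. -/
def bicausalCouplings (μ ν : Measure (ℝ × ℝ)) : Set (Measure ((ℝ × ℝ) × (ℝ × ℝ))) :=
  {π | π ∈ couplings μ ν ∧ IsCausal π ∧ IsCausal (π.map Prod.swap)}

/-- The `p`-transport cost `E^π[|X - X'|^p]^{1/p}` of a coupling. -/
noncomputable def transportCost (p : ℝ) (π : Measure ((ℝ × ℝ) × (ℝ × ℝ))) : ℝ≥0∞ :=
  (∫⁻ z, ENNReal.ofReal (euclDist z.1 z.2) ^ p ∂π) ^ (1 / p)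

/-- The `p`-Wasserstein distance. -/
noncomputable def wass (p : ℝ) (μ ν : Measure (ℝ × ℝ)) : ℝ≥0∞ :=
  ⨅ π ∈ couplings μ ν, transportCost p π

/-- The adapted `p`-Wasserstein distance. -/
noncomputable def adaptedWass (p : ℝ) (μ ν : Measure (ℝ × ℝ)) : ℝ≥0∞ :=
  ⨅ π ∈ bicausalCouplings μ ν, transportCost p π

/-- The distance from a measure to a set of measures. -/
noncomputable def distToSet (d : Measure (ℝ × ℝ) → Measure (ℝ × ℝ) → ℝ≥0∞)
    (μ : Measure (ℝ × ℝ)) (U : Set (Measure (ℝ × ℝ))) : ℝ≥0∞ :=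
  ⨅ ν ∈ U, d μ ν

/-- The pushforward `μ^T = μ ∘ (X + T)⁻¹`. -/
noncomputable def displace (μ : Measure (ℝ × ℝ)) (T : ℝ × ℝ → ℝ × ℝ) : Measure (ℝ × ℝ) :=
  μ.map (fun x => x + T x)

/-- `μ` has a finite `p`-th moment. -/
def HasFiniteMoment (p : ℝ) (μ : Measure (ℝ × ℝ)) : Prop :=
  ∫⁻ x, ENNReal.ofReal (euclDist x 0) ^ p ∂μ < ∞

/-- `I` is an interval and `ρ(dx) = q(x) 1_{x ∈ I} dx` with `q : I → [0, ∞)` continuous. -/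
def HasContDensityOn (ρ : Measure ℝ) (I : Set ℝ) : Prop :=
  I.OrdConnected ∧ ∃ q : ℝ → ℝ, ContinuousOn q I ∧ (∀ x ∈ I, 0 ≤ q x) ∧
    ρ = volume.withDensity (I.indicator fun x => ENNReal.ofReal (q x))

/-- `μ(dx) = k(x₁, x₂) dx₂ μ₁(dx₁)` with `k` bounded, where `μ₁` is the first marginal of `μ`. -/
def HasBoundedDisintegration (μ : Measure (ℝ × ℝ)) : Prop :=
  ∃ (k : ℝ × ℝ → ℝ) (K : ℝ), Measurable k ∧ (∀ x, 0 ≤ k x ∧ k x ≤ K) ∧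
    μ = ((μ.map Prod.fst).prod volume).withDensity fun x => ENNReal.ofReal (k x)

/-- The assumption on `μ` for the classical Wasserstein distance. -/
structure AssumptionWass (μ : Measure (ℝ × ℝ)) (I₁ I₂ : Set ℝ) : Prop where
  density : ∃ q : ℝ × ℝ → ℝ≥0∞, Measurable q ∧ μ = volume.withDensity q
  marginal₁ : HasContDensityOn (μ.map Prod.fst) I₁
  marginal₂ : HasContDensityOn (μ.map Prod.snd) I₂
  disintegration : HasBoundedDisintegration μ

/-- The assumption on `μ` for the adapted Wasserstein distance; the first marginal is arbitrary. -/
structure AssumptionAdapted (μ : Measure (ℝ × ℝ)) (I₂ : Set ℝ) : Prop where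
  disintegration : HasBoundedDisintegration μ
  marginal₂ : HasContDensityOn (μ.map Prod.snd) I₂

/-- `‖(E₁[Θ₁], E₂[Θ₂])‖ = ‖E^μ[Θ₁(X) | X₁]‖_{L^p} + ‖E^μ[Θ₂(X) | X₂]‖_{L^p}`, with functions of
one coordinate seen as functions on the plane. -/
noncomputable def marginalNorm (p : ℝ) (μ : Measure (ℝ × ℝ)) (Θ : ℝ × ℝ → ℝ × ℝ) : ℝ≥0∞ :=
  eLpNorm (μ[fun x => (Θ x).1 | MeasurableSpace.comap Prod.fst inferInstance])
      (ENNReal.ofReal p) μ +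
    eLpNorm (μ[fun x => (Θ x).2 | MeasurableSpace.comap Prod.snd inferInstance])
      (ENNReal.ofReal p) μ

end CouplingProj

namespace CouplingProj

/-! A coupling close to `μ^{rΘ}` is built by repairing its two marginals separately. The `i`-th
marginal of `μ^{rΘ}` is the law of `X_i + rΘ_i`; let `T_r` be the monotone rearrangement of `μ_i`
onto it. Running `T_r` backwards through a conditional kernel in each coordinate and gluing (`glue`)
turns `μ^{rΘ}` into an element of `Π(μ₁, μ₂)`, and by Minkowski the cost is at most the sum of the
two one-dimensional costs (`distToSet_wass_le`). If `Θ₁ = 0`, the first coordinate is left fixed,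
and such a coupling is bicausal (`distToSet_adaptedWass_le`).

It remains to see that each one-dimensional cost, divided by `r`, tends to `‖E[Z | X]‖_p`, with `X`
the coordinate and `Z` the component of `Θ` (`tendsto_cost_monotoneMap_div`). This is dominated
convergence: `|T_r x - x| ≤ rB` when `|Z| ≤ B`, and `(T_r x - x)/r → u(x)` almost everywhere, where
`E[Z | X] = u(X)`.

For the pointwise limit, `T_r x ≤ x + rc` means `P(X ≤ x) ≤ P(X + rZ ≤ x + rc)`, so it suffices to
compare these probabilities for small `r` (`ae_eventually_measureReal_displaced`). Rounding `Z` to a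
grid of mesh `ε` reduces this to finitely many monotone functions `P(X ≤ t, Z in a given cell)`,
which are differentiable almost everywhere. No regularity of the joint law is needed, and the
resulting constant is `C = 1`. -/

/-! ### Differentiation of distribution functions -/

theorem ae_hasDerivAt_setIntegral_Iic {ρ : Measure ℝ} [IsFiniteMeasure ρ] (hρ : ρ ≪ volume)
    {u : ℝ → ℝ} (hu : Integrable u ρ) :
    ∀ᵐ x ∂ρ, HasDerivAt (fun t => ∫ y in Set.Iic t, u y ∂ρ)
      ((ρ.rnDeriv volume x).toReal * u x) x := by
  have hint : Integrable (fun x => (ρ.rnDeriv volume x).toReal • u x) volume :=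
    (integrable_rnDeriv_smul_iff hρ).2 hu
  -- Lebesgue differentiation for integrals based at `0`; the change to `Iic` only adds a constant.
  filter_upwards [hρ (LocallyIntegrable.ae_hasDerivAt_integral hint.locallyIntegrable)] with x hx
  have h := (hx 0).add_const (∫ y in Set.Iic 0, u y ∂ρ)
  refine h.congr_of_eventuallyEq (Eventually.of_forall fun t => ?_)
  simp only [← setIntegral_rnDeriv_smul hρ (f := u) measurableSet_Iic]
  rw [← intervalIntegral.integral_Iic_sub_Iic hint.integrableOn hint.integrableOn]
  ring

theorem ae_rnDeriv_toReal_pos {ρ : Measure ℝ} [IsFiniteMeasure ρ] (hρ : ρ ≪ volume) :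
    ∀ᵐ x ∂ρ, 0 < (ρ.rnDeriv volume x).toReal := by
  filter_upwards [Measure.rnDeriv_pos hρ, hρ (Measure.rnDeriv_lt_top ρ volume)] with x h₁ h₂
  exact ENNReal.toReal_pos h₁.ne' h₂.ne

theorem hasDerivAt_nonneg_of_monotone {f : ℝ → ℝ} {f' x : ℝ} (h : HasDerivAt f f' x)
    (hf : Monotone f) : 0 ≤ f' := by
  rw [← h.deriv]
  exact hf.deriv_nonneg

theorem eventually_lt_of_hasDerivAt_pos {φ : ℝ → ℝ} {d : ℝ} (h : HasDerivAt φ d 0) (hd : 0 < d) :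
    ∀ᶠ r in 𝓝[>] (0 : ℝ), φ 0 < φ r := by
  filter_upwards [h.tendsto_slope_zero_right.eventually (lt_mem_nhds hd), self_mem_nhdsWithin]
    with r hr hr0
  simp only [zero_add, smul_eq_mul] at hr
  have := (pos_iff_pos_of_mul_pos hr).1 (inv_pos.2 hr0)
  linarith

/-! ### Decomposition along the fibers of a bounded integer-valued function -/

section Fibers

variable {Ω : Type*} [MeasurableSpace Ω] {μ : Measure Ω} [IsProbabilityMeasure μ]

theorem measureReal_eq_sum_fibers {k : Ω → ℤ} (hk : Measurable k) {J : Finset ℤ}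
    (hJ : ∀ ω, k ω ∈ J) {E : Set Ω} (hE : MeasurableSet E) :
    μ.real E = ∑ j ∈ J, μ.real (E ∩ k ⁻¹' {j}) := by
  rw [← measureReal_biUnion_finset]
  · congr 1
    ext ω
    simp [hJ ω]
  · intro i _ j _ hij
    exact Set.disjoint_left.2 fun ω h₁ h₂ => hij (h₁.2.symm.trans h₂.2)
  · exact fun j _ => hE.inter (hk (measurableSet_singleton j))

theorem integrable_fibers {k : Ω → ℤ} (hk : Measurable k) {J : Finset ℤ}
    (hJ : ∀ ω, k ω ∈ J) : Integrable (fun ω => (k ω : ℝ)) μ := by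
  refine Integrable.of_bound (C := ∑ j ∈ J, |(j : ℝ)|)
    ((measurable_from_top (f := fun j : ℤ => (j : ℝ))).comp hk).aestronglyMeasurable
    (Eventually.of_forall fun ω => ?_)
  exact Finset.single_le_sum (f := fun j : ℤ => |(j : ℝ)|) (fun _ _ => abs_nonneg _) (hJ ω)

theorem setIntegral_eq_sum_fibers {k : Ω → ℤ} (hk : Measurable k) {J : Finset ℤ}
    (hJ : ∀ ω, k ω ∈ J) (E : Set Ω) :
    ∫ ω in E, (k ω : ℝ) ∂μ = ∑ j ∈ J, (j : ℝ) * μ.real (E ∩ k ⁻¹' {j}) := by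
  have hm : ∀ j : ℤ, MeasurableSet (k ⁻¹' {j}) := fun j => hk (measurableSet_singleton j)
  have h : ∀ ω, (k ω : ℝ) = ∑ j ∈ J, (k ⁻¹' {j}).indicator (fun _ => (j : ℝ)) ω := by
    intro ω
    rw [Finset.sum_eq_single_of_mem (k ω) (hJ ω)]
    · simp
    · intro j _ hj
      exact Set.indicator_of_notMem (fun h => hj h.symm) _
  simp_rw [h]
  rw [integral_finsetSum]
  · refine Finset.sum_congr rfl fun j _ => ?_
    rw [integral_indicator (hm j), Measure.restrict_restrict (hm j), setIntegral_const,
      smul_eq_mul, mul_comm, Set.inter_comm]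
  · exact fun j _ => (integrable_const _).indicator (hm j)

theorem monotone_setIntegral_sublevel {μ : Measure Ω} {X W : Ω → ℝ} (hW : Integrable W μ)
    (h0 : ∀ ω, 0 ≤ W ω) : Monotone fun t => ∫ ω in {ω | X ω ≤ t}, W ω ∂μ := fun _ _ hst =>
  setIntegral_mono_set hW.integrableOn (Eventually.of_forall h0)
    (LE.le.eventuallyLE fun _ h => le_trans (Set.mem_ofPred.1 h) hst)

end Fibers

/-! ### First-order comparison of the laws of `X` and `X + rZ` -/

section Displacement

variable {Ω : Type*} [MeasurableSpace Ω] {μ : Measure Ω} [IsProbabilityMeasure μ]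
  {X Z : Ω → ℝ}

/-- On the cell `ε j ≤ Z < ε (j + 1)`, the event `X + rZ ≤ x + rc` lies between `X ≤ x + r(c - ε(j +
1))` and `X ≤ x + r(c - ε j)`. Summing over cells bounds the displaced probability by functions of
`r` differentiable at `0`, with slopes within `ε q(x)` of `q(x)(c - u(x))`, where `q` is the density
of `X`. The gap `ε` fixes the sign of the slope. The exceptional null set does not depend on `c`. -/
theorem ae_eventually_measureReal_displaced_of_gap (hX : Measurable X) (hZ : Measurable Z)
    {B : ℝ} (hB : ∀ ω, |Z ω| ≤ B) (hρ : μ.map X ≪ volume) {u : ℝ → ℝ} (hu : StronglyMeasurable u)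
    (huZ : μ[Z | MeasurableSpace.comap X inferInstance] =ᵐ[μ] u ∘ X) {ε : ℝ} (hε : 0 < ε) :
    ∀ᵐ x ∂μ.map X, ∀ c,
      (c + ε < u x → ∀ᶠ r in 𝓝[>] (0 : ℝ),
        μ.real {ω | X ω + r * Z ω ≤ x + r * c} < μ.real {ω | X ω ≤ x}) ∧
      (u x < c - ε → ∀ᶠ r in 𝓝[>] (0 : ℝ),
        μ.real {ω | X ω ≤ x} < μ.real {ω | X ω + r * Z ω ≤ x + r * c}) := by
  have hXle : ∀ t, MeasurableSet {ω | X ω ≤ t} := fun t => measurableSet_le hX measurable_const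
  have hZint : Integrable Z μ :=
    Integrable.of_bound hZ.aestronglyMeasurable B (Eventually.of_forall hB)
  let k : Ω → ℤ := fun ω => ⌊Z ω / ε⌋
  have hk : Measurable k := Int.measurable_floor.comp (hZ.div_const ε)
  let J : Finset ℤ := Finset.Icc ⌊-B / ε⌋ ⌊B / ε⌋
  have hJ : ∀ ω, k ω ∈ J := by
    intro ω
    have := abs_le.1 (hB ω)
    refine Finset.mem_Icc.2 ⟨Int.floor_le_floor ?_, Int.floor_le_floor ?_⟩
    · gcongr; exact this.1
    · gcongr; exact this.2
  have hkle : ∀ ω, ε * k ω ≤ Z ω := fun ω => by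
    have := Int.floor_le (Z ω / ε)
    rwa [le_div_iff₀ hε, mul_comm] at this
  have hklt : ∀ ω, Z ω < ε * (k ω + 1) := fun ω => by
    have := Int.lt_floor_add_one (Z ω / ε)
    rwa [div_lt_iff₀ hε, mul_comm] at this
  let F : ℤ → ℝ → ℝ := fun j t => μ.real ({ω | X ω ≤ t} ∩ k ⁻¹' {j})
  have hFmono : ∀ j, Monotone (F j) := fun j s t hst =>
    measureReal_mono (Set.inter_subset_inter_left _ fun _ h => le_trans (Set.mem_ofPred.1 h) hst)
  -- Monotone functions are differentiable Lebesgue-a.e., hence a.e. for the law of `X`; there are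
  -- countably many `j`.
  have hFdiff : ∀ᵐ x ∂μ.map X, ∀ j, DifferentiableAt ℝ (F j) x :=
    hρ (ae_all_iff.2 fun j => (hFmono j).ae_differentiableAt)
  have hcomap : MeasurableSpace.comap X inferInstance ≤ (inferInstance : MeasurableSpace Ω) :=
    hX.comap_le
  have hucomp : Integrable (u ∘ X) μ := integrable_condExp.congr huZ
  have huint : Integrable u (μ.map X) :=
    (integrable_map_measure hu.aestronglyMeasurable hX.aemeasurable).2 hucomp
  have hH : ∀ t, ∫ y in Set.Iic t, u y ∂μ.map X = ∫ ω in {ω | X ω ≤ t}, Z ω ∂μ := fun t => by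
    rw [setIntegral_map measurableSet_Iic hu.aestronglyMeasurable hX.aemeasurable,
      ← setIntegral_condExp hcomap hZint (s := {ω | X ω ≤ t}) ⟨Set.Iic t, measurableSet_Iic, rfl⟩]
    exact setIntegral_congr_ae (hXle t) (huZ.mono fun ω hω _ => hω.symm)
  have hF : ∀ t, ∫ _ in Set.Iic t, (1 : ℝ) ∂μ.map X = μ.real {ω | X ω ≤ t} := fun t => by
    rw [setIntegral_const, smul_eq_mul, mul_one, measureReal_def, measureReal_def,
      Measure.map_apply hX measurableSet_Iic]
    rfl
  have hkint : Integrable (fun ω => (k ω : ℝ)) μ := integrable_fibers hk hJ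
  filter_upwards [hFdiff, ae_hasDerivAt_setIntegral_Iic hρ huint,
    ae_hasDerivAt_setIntegral_Iic hρ (integrable_const (1 : ℝ)), ae_rnDeriv_toReal_pos hρ]
    with x hdiff hHx hFx hpos c
  simp only [hH] at hHx
  simp only [hF, mul_one] at hFx
  set q := ((μ.map X).rnDeriv volume x).toReal
  let f : ℤ → ℝ := fun j => deriv (F j) x
  have hf : ∀ j, HasDerivAt (F j) (f j) x := fun j => (hdiff j).hasDerivAt
  have hqsum : q = ∑ j ∈ J, f j := by
    refine hFx.unique ((HasDerivAt.fun_sum fun j _ => hf j).congr_of_eventuallyEq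
      (Eventually.of_forall fun t => ?_))
    exact measureReal_eq_sum_fibers hk hJ (hXle t)
  have hksum : HasDerivAt (fun t => ∫ ω in {ω | X ω ≤ t}, (k ω : ℝ) ∂μ) (∑ j ∈ J, j * f j) x := by
    refine (HasDerivAt.fun_sum fun j _ => (hf j).const_mul (j : ℝ)).congr_of_eventuallyEq
      (Eventually.of_forall fun t => ?_)
    exact setIntegral_eq_sum_fibers hk hJ _
  -- Since `Z - ε k ≥ 0`, its integral over `{X ≤ t}` is monotone in `t`, so its derivative at `x`
  -- is nonnegative. The upper bound `hupp` uses `ε k + ε - Z ≥ 0` in the same way.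
  have hlow : ε * ∑ j ∈ J, j * f j ≤ q * u x := by
    have h := hasDerivAt_nonneg_of_monotone (hHx.sub (hksum.const_mul ε)) (by
      convert monotone_setIntegral_sublevel (μ := μ) (X := X) (hZint.sub (hkint.const_mul ε))
        (fun ω => sub_nonneg.2 (hkle ω)) using 2 with t
      simp only [Pi.sub_apply]
      rw [integral_sub hZint.integrableOn (hkint.const_mul ε).integrableOn, integral_const_mul])
    linarith
  have hkint' : Integrable (fun ω => ε * (k ω : ℝ) + ε) μ :=
    (hkint.const_mul ε).add (integrable_const ε)
  have hupp : q * u x ≤ ε * ∑ j ∈ J, j * f j + ε * q := by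
    have h := hasDerivAt_nonneg_of_monotone
      (((hksum.const_mul ε).add (hFx.const_mul ε)).sub hHx) (by
      convert monotone_setIntegral_sublevel (μ := μ) (X := X) (hkint'.sub hZint)
        (fun ω => by have := hklt ω; simp only [Pi.sub_apply]; linarith) using 2 with t
      simp only [Pi.sub_apply, Pi.add_apply]
      rw [integral_sub hkint'.integrableOn hZint.integrableOn,
        integral_add (hkint.const_mul ε).integrableOn (integrable_const ε).integrableOn,
        integral_const_mul, setIntegral_const, smul_eq_mul, mul_comm ε (μ.real _)])
    linarith
  have hline : ∀ a : ℤ → ℝ, HasDerivAt (fun r : ℝ => ∑ j ∈ J, F j (x + r * a j))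
      (∑ j ∈ J, f j * a j) 0 := fun a => by
    refine HasDerivAt.fun_sum fun j _ => ?_
    have h₁ : HasDerivAt (fun r : ℝ => x + r * a j) (a j) 0 := by
      simpa using ((hasDerivAt_id (0 : ℝ)).mul_const (a j)).const_add x
    have h₂ : HasDerivAt (F j) (f j) (x + 0 * a j) := by simpa using hf j
    exact h₂.comp (0 : ℝ) h₁
  have hG : ∀ r, μ.real {ω | X ω + r * Z ω ≤ x + r * c}
      = ∑ j ∈ J, μ.real ({ω | X ω + r * Z ω ≤ x + r * c} ∩ k ⁻¹' {j}) := fun r =>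
    measureReal_eq_sum_fibers hk hJ
      (measurableSet_le (hX.add (hZ.const_mul r)) measurable_const)
  have hF0 : ∀ a : ℤ → ℝ, ∑ j ∈ J, F j (x + 0 * a j) = μ.real {ω | X ω ≤ x} := fun a => by
    simp only [zero_mul, add_zero]
    exact (measureReal_eq_sum_fibers hk hJ (hXle x)).symm
  -- `b = 0` rounds `Z` down and `b = 1` rounds it up.
  have hlin : ∀ b : ℝ, ∑ j ∈ J, f j * (c - ε * (j + b))
      = (c - ε * b) * q - ε * ∑ j ∈ J, j * f j := fun b => by
    rw [hqsum, Finset.mul_sum, Finset.mul_sum, ← Finset.sum_sub_distrib]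
    exact Finset.sum_congr rfl fun j _ => by ring
  constructor
  · intro hc
    have hd := (hline fun j => c - ε * (j + (0 : ℝ))).neg
    rw [hlin] at hd
    have := eventually_lt_of_hasDerivAt_pos hd (by nlinarith)
    filter_upwards [this, self_mem_nhdsWithin] with r hr (hr0 : 0 < r)
    simp only [Pi.neg_apply] at hr
    rw [hF0, neg_lt_neg_iff] at hr
    refine lt_of_le_of_lt ?_ hr
    rw [hG]
    refine Finset.sum_le_sum fun j _ => measureReal_mono ?_
    rintro ω ⟨h₁, rfl : k ω = j⟩
    refine ⟨?_, rfl⟩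
    simp only [Set.mem_ofPred_eq] at h₁ ⊢
    nlinarith [mul_le_mul_of_nonneg_left (hkle ω) hr0.le]
  · intro hc
    have hd := hline fun j => c - ε * (j + (1 : ℝ))
    rw [hlin] at hd
    have := eventually_lt_of_hasDerivAt_pos hd (by nlinarith)
    filter_upwards [this, self_mem_nhdsWithin] with r hr (hr0 : 0 < r)
    rw [hF0] at hr
    refine lt_of_lt_of_le hr ?_
    rw [hG]
    refine Finset.sum_le_sum fun j _ => measureReal_mono ?_
    rintro ω ⟨h₁, rfl : k ω = j⟩
    refine ⟨?_, rfl⟩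
    simp only [Set.mem_ofPred_eq] at h₁ ⊢
    nlinarith [mul_le_mul_of_nonneg_left (hklt ω).le hr0.le]

theorem ae_eventually_measureReal_displaced (hX : Measurable X) (hZ : Measurable Z)
    {B : ℝ} (hB : ∀ ω, |Z ω| ≤ B) (hρ : μ.map X ≪ volume) {u : ℝ → ℝ} (hu : StronglyMeasurable u)
    (huZ : μ[Z | MeasurableSpace.comap X inferInstance] =ᵐ[μ] u ∘ X) :
    ∀ᵐ x ∂μ.map X, ∀ c,
      (c < u x → ∀ᶠ r in 𝓝[>] (0 : ℝ),
        μ.real {ω | X ω + r * Z ω ≤ x + r * c} < μ.real {ω | X ω ≤ x}) ∧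
      (u x < c → ∀ᶠ r in 𝓝[>] (0 : ℝ),
        μ.real {ω | X ω ≤ x} < μ.real {ω | X ω + r * Z ω ≤ x + r * c}) := by
  -- Countably many gaps `1/(n + 1)` keep a single null set while reaching every strict inequality.
  have h := ae_all_iff.2 fun n : ℕ => ae_eventually_measureReal_displaced_of_gap hX hZ hB hρ hu huZ
    (Nat.one_div_pos_of_nat (α := ℝ) (n := n))
  filter_upwards [h] with x hx c
  constructor
  · intro hc
    obtain ⟨n, hn⟩ := exists_nat_one_div_lt (sub_pos.2 hc)
    exact (hx n c).1 (by linarith)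
  · intro hc
    obtain ⟨n, hn⟩ := exists_nat_one_div_lt (sub_pos.2 hc)
    exact (hx n c).2 (by linarith)

/-- Almost every point is a point of strict left increase of the distribution function: this is the
displacement comparison with `Z = 0` and `c = -1`. It supplies the strict inequality needed to bound
the monotone map from below. -/
theorem ae_measureReal_lt_of_lt (hX : Measurable X) (hρ : μ.map X ≪ volume) :
    ∀ᵐ x ∂μ.map X, ∀ y < x, μ.real {ω | X ω ≤ y} < μ.real {ω | X ω ≤ x} := by
  have h := ae_eventually_measureReal_displaced (Z := fun _ => 0) (B := 0) hX measurable_const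
    (by simp) hρ (u := fun _ => 0) stronglyMeasurable_const
    (by
      have : (fun _ : Ω => (0 : ℝ)) = 0 := rfl
      rw [this, condExp_zero]; rfl)
  filter_upwards [h] with x hx y hy
  have h₁ := (hx (-1)).1 (by norm_num)
  have h₂ : ∀ᶠ r in 𝓝[>] (0 : ℝ), r < x - y :=
    mem_nhdsWithin_of_mem_nhds (gt_mem_nhds (sub_pos.2 hy))
  obtain ⟨r, hr₁, hr₂⟩ := (h₁.and h₂).exists
  refine lt_of_le_of_lt (measureReal_mono fun ω hω => ?_) hr₁
  simp only [Set.mem_ofPred_eq] at hω ⊢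
  linarith

end Displacement

/-! ### Monotone rearrangement on the line -/

section MonotoneMap

open ProbabilityTheory

/-- The monotone rearrangement `Q_ν ∘ F_ρ` of `ρ` onto `ν`, with `F_ρ` the distribution function of
`ρ` and `Q_ν` the quantile function of `ν`; it is set to `0` where `F_ρ` is `0` or `1`. -/
noncomputable def monotoneMap (ρ ν : Measure ℝ) (x : ℝ) : ℝ :=
  open Classical in
  if cdf ρ x ∈ Set.Ioo 0 1 then sInf {y | cdf ρ x ≤ cdf ν y} else 0

/-- The Galois connection between quantile and distribution function, from right continuity. The
condition `0 < t < 1` makes the set nonempty and bounded below, so that the real `sInf` is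
meaningful. -/
theorem sInf_le_iff_le_cdf (ν : Measure ℝ) {t : ℝ} (ht : t ∈ Set.Ioo (0 : ℝ) 1) (y : ℝ) :
    sInf {z | t ≤ cdf ν z} ≤ y ↔ t ≤ cdf ν y := by
  have hne : {z | t ≤ cdf ν z}.Nonempty :=
    ((tendsto_cdf_atTop ν).eventually (lt_mem_nhds ht.2)).exists.imp fun z hz => hz.le
  have hbdd : BddBelow {z | t ≤ cdf ν z} := by
    obtain ⟨z, hz⟩ := ((tendsto_cdf_atBot ν).eventually (gt_mem_nhds ht.1)).exists
    refine ⟨z, fun w hw => le_of_lt ?_⟩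
    by_contra! h
    exact absurd (monotone_cdf ν h) (not_le.2 (hz.trans_le hw))
  refine ⟨fun h => ?_, fun h => csInf_le hbdd h⟩
  have hcont : Tendsto (cdf ν) (𝓝[>] y) (𝓝 (cdf ν y)) :=
    ((cdf ν).right_continuous y).mono_left (nhdsWithin_mono _ Set.Ioi_subset_Ici_self)
  refine ge_of_tendsto hcont ?_
  filter_upwards [self_mem_nhdsWithin] with z (hz : y < z)
  obtain ⟨w, hw, hwz⟩ := exists_lt_of_csInf_lt hne (h.trans_lt hz)
  exact le_trans (Set.mem_ofPred.1 hw) (monotone_cdf ν hwz.le)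

theorem monotoneMap_le_iff {ρ : Measure ℝ} (ν : Measure ℝ) {x : ℝ}
    (hx : cdf ρ x ∈ Set.Ioo 0 1) (y : ℝ) : monotoneMap ρ ν x ≤ y ↔ cdf ρ x ≤ cdf ν y := by
  rw [monotoneMap, if_pos hx, sInf_le_iff_le_cdf ν hx]

theorem measurable_monotoneMap (ρ ν : Measure ℝ) : Measurable (monotoneMap ρ ν) := by
  have hF : Measurable (cdf ρ) := (monotone_cdf ρ).measurable
  have hA : MeasurableSet {x | cdf ρ x ∈ Set.Ioo (0 : ℝ) 1} := hF measurableSet_Ioo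
  refine measurable_of_Iic fun y => ?_
  have : monotoneMap ρ ν ⁻¹' Set.Iic y =
      ({x | cdf ρ x ∈ Set.Ioo (0 : ℝ) 1} ∩ {x | cdf ρ x ≤ cdf ν y}) ∪
      ({x | cdf ρ x ∈ Set.Ioo (0 : ℝ) 1}ᶜ ∩ {_x | (0 : ℝ) ≤ y}) := by
    ext x
    by_cases hx : cdf ρ x ∈ Set.Ioo (0 : ℝ) 1
    · have h₁ := monotoneMap_le_iff ν hx y
      simp only [Set.mem_preimage, Set.mem_Iic, h₁, Set.mem_union, Set.mem_inter_iff,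
        Set.mem_ofPred_eq, hx, Set.mem_compl_iff, true_and, not_true_eq_false, false_and, or_false]
    · have h₁ : monotoneMap ρ ν x = 0 := if_neg hx
      simp only [Set.mem_preimage, Set.mem_Iic, h₁, Set.mem_union, Set.mem_inter_iff,
        Set.mem_ofPred_eq, hx, Set.mem_compl_iff, true_and, not_false_eq_true, false_and, false_or]
  rw [this]
  exact (hA.inter (measurableSet_le hF measurable_const)).union (hA.compl.inter (.const _))

variable {ρ : Measure ℝ} [IsProbabilityMeasure ρ] [NullSingletonClass ρ]

theorem continuous_cdf : Continuous (cdf ρ) := by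
  refine continuous_iff_continuousAt.2 fun x => ?_
  rw [(monotone_cdf ρ).continuousAt_iff_leftLim_eq_rightLim, StieltjesFunction.rightLim_eq]
  -- The jump at `x` is the mass of `{x}`, which vanishes.
  have h := (cdf ρ).measure_singleton x
  rw [measure_cdf, measure_singleton, eq_comm, ENNReal.ofReal_eq_zero] at h
  exact le_antisymm ((monotone_cdf ρ).leftLim_le le_rfl) (by linarith)

theorem exists_cdf_eq {t : ℝ} (ht : t ∈ Set.Ioo (0 : ℝ) 1) : ∃ x, cdf ρ x = t :=
  mem_range_of_exists_le_of_exists_ge continuous_cdf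
    (((tendsto_cdf_atBot ρ).eventually (gt_mem_nhds ht.1)).exists.imp fun _ h => h.le)
    (((tendsto_cdf_atTop ρ).eventually (lt_mem_nhds ht.2)).exists.imp fun _ h => h.le)

/-- The distribution function of an atomless law is uniformly distributed. Levels `s` near `t` in
`(0, 1)` are attained, `s = F(x)`, and `{F ≤ t}` is compared with `Iic x`, whose mass is `s`. -/
theorem measureReal_cdf_le {t : ℝ} (ht : t ∈ Set.Icc (0 : ℝ) 1) :
    ρ.real {x | cdf ρ x ≤ t} = t := by
  refine le_antisymm ?_ ?_
  · rcases ht.2.eq_or_lt with rfl | h1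
    · exact measureReal_le_one
    refine le_of_forall_gt_imp_ge_of_dense fun s hs => ?_
    rcases lt_or_ge s 1 with hs1 | hs1
    · obtain ⟨x, hx⟩ := exists_cdf_eq (ρ := ρ) ⟨ht.1.trans_lt hs, hs1⟩
      rw [← hx, cdf_eq_real]
      refine measureReal_mono fun y hy => ?_
      by_contra! h
      rw [Set.mem_Iic, not_le] at h
      have := monotone_cdf ρ h.le
      rw [Set.mem_ofPred_eq] at hy
      linarith
    · exact measureReal_le_one.trans hs1
  · rcases ht.1.eq_or_lt with rfl | h0
    · exact measureReal_nonneg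
    refine le_of_forall_lt_imp_le_of_dense fun s hs => ?_
    rcases lt_or_ge 0 s with hs0 | hs0
    · obtain ⟨x, hx⟩ := exists_cdf_eq (ρ := ρ) ⟨hs0, hs.trans_le ht.2⟩
      conv_lhs => rw [← hx, cdf_eq_real]
      exact measureReal_mono fun y hy => (monotone_cdf ρ hy).trans (hx.trans_le hs.le)
    · exact hs0.trans measureReal_nonneg

theorem ae_cdf_mem_Ioo : ∀ᵐ x ∂ρ, cdf ρ x ∈ Set.Ioo (0 : ℝ) 1 := by
  have h0 : ∀ᵐ x ∂ρ, ¬ cdf ρ x ≤ 0 := by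
    have := measureReal_cdf_le (ρ := ρ) (t := 0) (by simp)
    rw [measureReal_eq_zero_iff] at this
    rw [ae_iff]
    simpa using this
  have h1 : ∀ᵐ x ∂ρ, cdf ρ x < 1 := by
    have hF : Measurable (cdf ρ) := (monotone_cdf ρ).measurable
    have hm : MeasurableSet {x | cdf ρ x < 1} := measurableSet_lt hF measurable_const
    rw [ae_iff, ← Set.compl_ofPred, ← measureReal_eq_zero_iff, probReal_compl_eq_one_sub hm,
      sub_eq_zero]
    refine le_antisymm (le_of_forall_lt_imp_le_of_dense fun s hs => ?_) measureReal_le_one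
    rcases lt_or_ge 0 s with hs0 | hs0
    · rw [← measureReal_cdf_le (ρ := ρ) ⟨hs0.le, hs.le⟩]
      exact measureReal_mono fun y hy => lt_of_le_of_lt (Set.mem_ofPred.1 hy) hs
    · exact hs0.trans measureReal_nonneg
  filter_upwards [h0, h1] with x hx₀ hx₁ using ⟨not_le.1 hx₀, hx₁⟩

/-- Almost everywhere, the image lies below `y` exactly when `F_ρ ≤ F_ν(y)`, an event of mass
`F_ν(y)` by uniformity. -/
theorem map_monotoneMap (ν : Measure ℝ) [IsProbabilityMeasure ν] :
    ρ.map (monotoneMap ρ ν) = ν := by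
  have : IsProbabilityMeasure (ρ.map (monotoneMap ρ ν)) :=
    Measure.isProbabilityMeasure_map (measurable_monotoneMap ρ ν).aemeasurable
  refine Measure.ext_of_Iic _ _ fun y => ?_
  rw [Measure.map_apply (measurable_monotoneMap ρ ν) measurableSet_Iic]
  have h : ρ (monotoneMap ρ ν ⁻¹' Set.Iic y) = ρ {x | cdf ρ x ≤ cdf ν y} := by
    refine measure_congr ?_
    filter_upwards [ae_cdf_mem_Ioo (ρ := ρ)] with x hx
    exact propext (monotoneMap_le_iff ν hx y)
  rw [h, ← ofReal_cdf ν y, ← ofReal_measureReal,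
    measureReal_cdf_le ⟨cdf_nonneg ν y, cdf_le_one ν y⟩]

end MonotoneMap

/-! ### First-order asymptotics of the one-dimensional transport cost -/

section Rate

variable {Ω : Type*} [MeasurableSpace Ω] {μ : Measure Ω} [IsProbabilityMeasure μ]
  {X Z : Ω → ℝ}

theorem cdf_map_eq (hX : Measurable X) (t : ℝ) :
    ProbabilityTheory.cdf (μ.map X) t = μ.real {ω | X ω ≤ t} := by
  have := Measure.isProbabilityMeasure_map (μ := μ) hX.aemeasurable
  rw [ProbabilityTheory.cdf_eq_real, measureReal_def, measureReal_def,
    Measure.map_apply hX measurableSet_Iic]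
  rfl

theorem nullSingletonClass_of_absolutelyContinuous {ρ : Measure ℝ} (hρ : ρ ≪ volume) :
    NullSingletonClass ρ :=
  ⟨fun x => hρ (measure_singleton x)⟩

theorem ae_abs_monotoneMap_sub_le (hX : Measurable X) (hZ : Measurable Z)
    {B : ℝ} (hB : ∀ ω, |Z ω| ≤ B) (hρ : μ.map X ≪ volume) :
    ∀ᵐ x ∂μ.map X, ∀ r > 0,
      |monotoneMap (μ.map X) (μ.map fun ω => X ω + r * Z ω) x - x| ≤ r * B := by
  have := Measure.isProbabilityMeasure_map (μ := μ) hX.aemeasurable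
  have := nullSingletonClass_of_absolutelyContinuous hρ
  filter_upwards [ae_measureReal_lt_of_lt hX hρ, ae_cdf_mem_Ioo (ρ := μ.map X)] with x hx h01 r hr
  have hiff := monotoneMap_le_iff (μ.map fun ω => X ω + r * Z ω) h01
  have hXZ : Measurable fun ω => X ω + r * Z ω := hX.add (hZ.const_mul r)
  simp only [cdf_map_eq hX, cdf_map_eq hXZ] at hiff
  have hZr : ∀ ω, -(r * B) ≤ r * Z ω ∧ r * Z ω ≤ r * B := fun ω => by
    have := abs_le.1 (hB ω)
    constructor <;> nlinarith
  rw [abs_le]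
  constructor
  · have : x - r * B ≤ monotoneMap (μ.map X) (μ.map fun ω => X ω + r * Z ω) x := by
      refine le_of_forall_lt fun y hy => ?_
      rw [← not_le, hiff, not_le]
      -- `X + rZ ≤ y` forces `X ≤ y + rB`, and `y + rB < x`.
      refine lt_of_le_of_lt (measureReal_mono fun ω hω => ?_) (hx (y + r * B) (by linarith))
      have := hZr ω
      simp only [Set.mem_ofPred_eq] at hω ⊢
      linarith
    linarith
  · have := (hiff (x + r * B)).2 (measureReal_mono fun ω hω => by
      have := hZr ω
      simp only [Set.mem_ofPred_eq] at hω ⊢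
      linarith)
    linarith

/-- By the Galois connection, the quotient is at most `c` exactly when `P(X ≤ x) ≤ P(X + rZ ≤ x +
rc)`, which is decided for small `r` by the sign of `c - u(x)`. -/
theorem ae_tendsto_monotoneMap_sub_div (hX : Measurable X) (hZ : Measurable Z)
    {B : ℝ} (hB : ∀ ω, |Z ω| ≤ B) (hρ : μ.map X ≪ volume) {u : ℝ → ℝ} (hu : StronglyMeasurable u)
    (huZ : μ[Z | MeasurableSpace.comap X inferInstance] =ᵐ[μ] u ∘ X) :
    ∀ᵐ x ∂μ.map X, Tendsto
      (fun r => (monotoneMap (μ.map X) (μ.map fun ω => X ω + r * Z ω) x - x) / r)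
      (𝓝[>] 0) (𝓝 (u x)) := by
  have := Measure.isProbabilityMeasure_map (μ := μ) hX.aemeasurable
  have := nullSingletonClass_of_absolutelyContinuous hρ
  filter_upwards [ae_eventually_measureReal_displaced hX hZ hB hρ hu huZ,
    ae_cdf_mem_Ioo (ρ := μ.map X)] with x hx h01
  have hiff := fun r => monotoneMap_le_iff (μ.map fun ω => X ω + r * Z ω) h01
  have hXZ : ∀ r, Measurable fun ω => X ω + r * Z ω := fun r => hX.add (hZ.const_mul r)
  simp only [cdf_map_eq hX, cdf_map_eq (hXZ _)] at hiff
  refine tendsto_order.2 ⟨fun c hc => ?_, fun c hc => ?_⟩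
  · filter_upwards [(hx c).1 hc, self_mem_nhdsWithin] with r hr (hr0 : 0 < r)
    rw [lt_div_iff₀ hr0]
    have := not_le.1 fun h => not_le.2 hr ((hiff r (x + r * c)).1 h)
    linarith
  -- The comparison yields only a non-strict bound, so it is applied at some `d` strictly below `c`.
  · obtain ⟨d, hd, hdc⟩ := exists_between hc
    filter_upwards [(hx d).2 hd, self_mem_nhdsWithin] with r hr (hr0 : 0 < r)
    rw [div_lt_iff₀ hr0]
    have := (hiff r (x + r * d)).2 hr.le
    nlinarith

/-- The `p`-cost of the monotone rearrangement of the law of `X` onto that of `X + r Z` is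
asymptotically `r` times the `L^p` norm of `E[Z | X]`. -/
theorem tendsto_cost_monotoneMap_div {p : ℝ} (hp : 0 < p) (hX : Measurable X) (hZ : Measurable Z)
    {B : ℝ} (hB : ∀ ω, |Z ω| ≤ B) (hρ : μ.map X ≪ volume) :
    Tendsto (fun r : ℝ => (∫⁻ x, ENNReal.ofReal
        |monotoneMap (μ.map X) (μ.map fun ω => X ω + r * Z ω) x - x| ^ p ∂μ.map X) ^ (1 / p) /
        ENNReal.ofReal r) (𝓝[>] 0)
      (𝓝 (eLpNorm (μ[Z | MeasurableSpace.comap X inferInstance]) (ENNReal.ofReal p) μ)) := by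
  have := Measure.isProbabilityMeasure_map (μ := μ) hX.aemeasurable
  obtain ⟨u, hu, huZ⟩ := StronglyMeasurable.exists_eq_measurable_comp (f := X)
    (g := μ[Z | MeasurableSpace.comap X inferInstance]) stronglyMeasurable_condExp
  have hnorm : eLpNorm (μ[Z | MeasurableSpace.comap X inferInstance]) (ENNReal.ofReal p) μ =
      (∫⁻ x, ENNReal.ofReal |u x| ^ p ∂μ.map X) ^ (1 / p) := by
    rw [huZ, ← eLpNorm_map_measure hu.aestronglyMeasurable hX.aemeasurable,
      eLpNorm_eq_lintegral_rpow_enorm_toReal (by simpa using hp) ENNReal.ofReal_ne_top,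
      ENNReal.toReal_ofReal hp.le]
    simp only [Real.enorm_eq_ofReal_abs]
  rw [hnorm]
  have hlim : Tendsto (fun r : ℝ => ∫⁻ x, ENNReal.ofReal
      |(monotoneMap (μ.map X) (μ.map fun ω => X ω + r * Z ω) x - x) / r| ^ p ∂μ.map X) (𝓝[>] 0)
      (𝓝 (∫⁻ x, ENNReal.ofReal |u x| ^ p ∂μ.map X)) := by
    refine tendsto_lintegral_filter_of_dominated_convergence (fun _ => ENNReal.ofReal B ^ p)
      (Eventually.of_forall fun r => ?_) ?_ ?_ ?_
    · have := measurable_monotoneMap (μ.map X) (μ.map fun ω => X ω + r * Z ω)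
      have h := ((this.sub measurable_id).div_const r).norm.ennreal_ofReal.pow_const p
      exact h
    · filter_upwards [self_mem_nhdsWithin] with r (hr : 0 < r)
      filter_upwards [ae_abs_monotoneMap_sub_le hX hZ hB hρ] with x hx
      gcongr
      rw [abs_div, abs_of_pos hr, div_le_iff₀ hr, mul_comm]
      exact hx r hr
    · rw [lintegral_const, measure_univ, mul_one]
      exact ENNReal.rpow_ne_top_of_nonneg hp.le ENNReal.ofReal_ne_top
    · filter_upwards [ae_tendsto_monotoneMap_sub_div hX hZ hB hρ hu huZ.eventuallyEq] with x hx
      exact ((ENNReal.continuous_rpow_const (y := p)).tendsto _).comp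
        ((ENNReal.continuous_ofReal.tendsto _).comp hx.abs)
  -- The factor `r^{-p}` inside the integral becomes the division by `r` after the `p`-th root.
  refine Tendsto.congr' ?_ (((ENNReal.continuous_rpow_const (y := 1 / p)).tendsto _).comp hlim)
  filter_upwards [self_mem_nhdsWithin] with r (hr : 0 < r)
  have hr' : ENNReal.ofReal r ≠ 0 := by simpa using hr
  have hrp : ∀ a : ℝ, ENNReal.ofReal |a / r| ^ p =
      ENNReal.ofReal |a| ^ p * (ENNReal.ofReal r ^ p)⁻¹ := fun a => by
    rw [abs_div, abs_of_pos hr, ENNReal.ofReal_div_of_pos hr, ENNReal.div_rpow_of_nonneg _ _ hp.le,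
      div_eq_mul_inv]
  have hrtop : (ENNReal.ofReal r ^ p)⁻¹ ≠ ∞ :=
    ENNReal.inv_ne_top.2 (ENNReal.rpow_pos (pos_iff_ne_zero.2 hr') ENNReal.ofReal_ne_top).ne'
  simp only [Function.comp, hrp]
  rw [lintegral_mul_const' _ _ hrtop, ENNReal.mul_rpow_of_nonneg _ _ (by positivity),
    ENNReal.inv_rpow, ← ENNReal.rpow_mul, mul_one_div_cancel hp.ne', ENNReal.rpow_one,
    div_eq_mul_inv (_ ^ _)]

end Rate

/-! ### Gluing one-dimensional transports into a coupling on the plane -/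

section Glue

open ProbabilityTheory

/-- The law of `(Y, Y')` where `Y` has law `ν` and, given `Y`, the coordinates `Y'₁` and `Y'₂` are
independent with laws `κ₁(Y₁, ·)` and `κ₂(Y₂, ·)`. -/
noncomputable def glue (ν : Measure (ℝ × ℝ)) (κ₁ κ₂ : Kernel ℝ ℝ) :
    Measure ((ℝ × ℝ) × (ℝ × ℝ)) :=
  ν.compProd ((κ₁.comap Prod.fst measurable_fst).prod (κ₂.comap Prod.snd measurable_snd))

variable (ν : Measure (ℝ × ℝ)) [IsProbabilityMeasure ν] (κ₁ κ₂ : Kernel ℝ ℝ) [IsMarkovKernel κ₁]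
  [IsMarkovKernel κ₂]

instance : IsProbabilityMeasure (glue ν κ₁ κ₂) := by
  unfold glue
  infer_instance

theorem map_fst_glue : (glue ν κ₁ κ₂).map Prod.fst = ν :=
  Measure.fst_compProd ν _

theorem lintegral_glue {f : (ℝ × ℝ) × (ℝ × ℝ) → ℝ≥0∞} (hf : Measurable f) :
    ∫⁻ z, f z ∂glue ν κ₁ κ₂ = ∫⁻ y, ∫⁻ a, ∫⁻ b, f (y, (a, b)) ∂κ₂ y.2 ∂κ₁ y.1 ∂ν := by
  rw [glue, Measure.lintegral_compProd hf]
  refine lintegral_congr fun y => ?_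
  exact Kernel.lintegral_prod _ _ y (hf.comp measurable_prodMk_left)

theorem map_glue_fst_coordinates :
    (glue ν κ₁ κ₂).map (fun z => (z.1.1, z.2.1)) = (ν.map Prod.fst).compProd κ₁ := by
  have := Measure.isProbabilityMeasure_map (μ := ν) measurable_fst.aemeasurable
  refine Measure.ext_of_lintegral _ fun f hf => ?_
  rw [lintegral_map hf (by fun_prop), lintegral_glue ν κ₁ κ₂ (by fun_prop),
    Measure.lintegral_compProd hf, lintegral_map (by fun_prop) measurable_fst]
  simp

theorem map_glue_snd_coordinates :
    (glue ν κ₁ κ₂).map (fun z => (z.1.2, z.2.2)) = (ν.map Prod.snd).compProd κ₂ := by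
  have := Measure.isProbabilityMeasure_map (μ := ν) measurable_snd.aemeasurable
  refine Measure.ext_of_lintegral _ fun f hf => ?_
  rw [lintegral_map hf (by fun_prop), lintegral_glue ν κ₁ κ₂ (by fun_prop),
    Measure.lintegral_compProd hf, lintegral_map (by fun_prop) measurable_snd]
  simp

theorem map_snd_glue_mem_couplings {μ₁ μ₂ : Measure ℝ}
    (h₁ : ((ν.map Prod.fst).compProd κ₁).map Prod.snd = μ₁)
    (h₂ : ((ν.map Prod.snd).compProd κ₂).map Prod.snd = μ₂) :
    (glue ν κ₁ κ₂).map Prod.snd ∈ couplings μ₁ μ₂ := by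
  refine ⟨Measure.isProbabilityMeasure_map measurable_snd.aemeasurable, ?_, ?_⟩
  · rw [Measure.map_map measurable_fst measurable_snd, ← h₁, ← map_glue_fst_coordinates ν κ₁ κ₂,
      Measure.map_map measurable_snd (by fun_prop)]
    rfl
  · rw [Measure.map_map measurable_snd measurable_snd, ← h₂, ← map_glue_snd_coordinates ν κ₁ κ₂,
      Measure.map_map measurable_snd (by fun_prop)]
    rfl

theorem glue_mem_couplings : glue ν κ₁ κ₂ ∈ couplings ν ((glue ν κ₁ κ₂).map Prod.snd) :=
  ⟨inferInstance, map_fst_glue ν κ₁ κ₂, rfl⟩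

theorem euclDist_le_add_abs (x y : ℝ × ℝ) : euclDist x y ≤ |x.1 - y.1| + |x.2 - y.2| := by
  refine Real.sqrt_le_iff.2 ⟨by positivity, ?_⟩
  nlinarith [sq_abs (x.1 - y.1), sq_abs (x.2 - y.2),
    mul_nonneg (abs_nonneg (x.1 - y.1)) (abs_nonneg (x.2 - y.2))]

/-- The Euclidean norm is at most the `ℓ¹` norm; Minkowski then separates the coordinates, and each
term sees only the joint law of one coordinate pair. -/
theorem transportCost_glue_le {p : ℝ} (hp : 1 ≤ p) :
    transportCost p (glue ν κ₁ κ₂) ≤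
      (∫⁻ w, ENNReal.ofReal |w.1 - w.2| ^ p ∂(ν.map Prod.fst).compProd κ₁) ^ (1 / p) +
      (∫⁻ w, ENNReal.ofReal |w.1 - w.2| ^ p ∂(ν.map Prod.snd).compProd κ₂) ^ (1 / p) := by
  have hm : Measurable fun w : ℝ × ℝ => ENNReal.ofReal |w.1 - w.2| := by fun_prop
  rw [← map_glue_fst_coordinates ν κ₁ κ₂, ← map_glue_snd_coordinates ν κ₁ κ₂,
    lintegral_map (hm.pow_const p) (by fun_prop), lintegral_map (hm.pow_const p) (by fun_prop)]
  refine le_trans ?_ (ENNReal.lintegral_Lp_add_le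
    (f := fun z : (ℝ × ℝ) × (ℝ × ℝ) => ENNReal.ofReal |z.1.1 - z.2.1|)
    (g := fun z : (ℝ × ℝ) × (ℝ × ℝ) => ENNReal.ofReal |z.1.2 - z.2.2|)
    (by fun_prop) (by fun_prop) hp)
  unfold transportCost
  gcongr with z
  rw [Pi.add_apply, ← ENNReal.ofReal_add (abs_nonneg _) (abs_nonneg _)]
  exact ENNReal.ofReal_le_ofReal (euclDist_le_add_abs _ _)

/-- When `X'₁ = X₁`, the factor `g(X'₁)` is a function of the conditioning variable and pulls out.
The condition is symmetric under swapping, so it gives both directions of causality. -/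
theorem isCausal_of_ae_eq {π : Measure ((ℝ × ℝ) × (ℝ × ℝ))} [IsProbabilityMeasure π]
    (h : ∀ᵐ z ∂π, z.2.1 = z.1.1) : IsCausal π := by
  rintro f g hf hg ⟨c, hc⟩ ⟨d, hd⟩
  set m := MeasurableSpace.comap (fun z : (ℝ × ℝ) × (ℝ × ℝ) => z.1.1) inferInstance
  have hm : m ≤ Prod.instMeasurableSpace :=
    Measurable.comap_le (f := fun z : (ℝ × ℝ) × (ℝ × ℝ) => z.1.1)
      (measurable_fst.comp measurable_fst)
  have hgm : StronglyMeasurable[m] fun z : (ℝ × ℝ) × (ℝ × ℝ) => g z.1.1 :=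
    (hg.comp (comap_measurable _)).stronglyMeasurable
  have hfint : Integrable (fun z : (ℝ × ℝ) × (ℝ × ℝ) => f z.1) π :=
    Integrable.of_bound (hf.comp measurable_fst).aestronglyMeasurable c
      (Eventually.of_forall fun z => hc z.1)
  have hgint : Integrable (fun z : (ℝ × ℝ) × (ℝ × ℝ) => g z.1.1) π :=
    Integrable.of_bound (hgm.mono hm).aestronglyMeasurable d
      (Eventually.of_forall fun z => hd z.1.1)
  have h₁ : π[fun z => f z.1 * g z.2.1 | m] =ᵐ[π] π[fun z => g z.1.1 * f z.1 | m] :=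
    condExp_congr_ae (h.mono fun z hz => by simp only [hz, mul_comm])
  have h₂ : π[fun z => g z.2.1 | m] =ᵐ[π] π[fun z => g z.1.1 | m] :=
    condExp_congr_ae (h.mono fun z hz => by simp only [hz])
  have h₃ := condExp_stronglyMeasurable_mul_of_bound hm hgm hfint d
    (Eventually.of_forall fun z => hd z.1.1)
  rw [condExp_of_stronglyMeasurable hm hgm hgint] at h₂
  filter_upwards [h₁, h₂, h₃] with z hz₁ hz₂ hz₃
  rw [hz₁, Pi.mul_apply, hz₂, mul_comm]
  exact hz₃

theorem ae_glue_id_fst_eq : ∀ᵐ z ∂glue ν Kernel.id κ₂, z.2.1 = z.1.1 := by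
  have hs : MeasurableSet {z : (ℝ × ℝ) × (ℝ × ℝ) | z.2.1 = z.1.1}ᶜ :=
    (measurableSet_eq_fun (by fun_prop) (by fun_prop)).compl
  rw [ae_iff, ← Set.compl_ofPred, ← lintegral_indicator_one hs,
    lintegral_glue _ _ _ (measurable_one.indicator hs)]
  simp only [Kernel.id_apply]
  refine (lintegral_congr fun y => ?_).trans lintegral_zero
  rw [lintegral_dirac']
  · simp
  · exact Measurable.lintegral_prod_right' (f := fun q : ℝ × ℝ => Set.indicator _ _ (y, q))
      ((measurable_one.indicator hs).comp measurable_prodMk_left)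

theorem glue_id_mem_bicausalCouplings :
    glue ν Kernel.id κ₂ ∈ bicausalCouplings ν ((glue ν Kernel.id κ₂).map Prod.snd) := by
  have hae := ae_glue_id_fst_eq ν κ₂
  have := Measure.isProbabilityMeasure_map (μ := glue ν Kernel.id κ₂) measurable_swap.aemeasurable
  refine ⟨glue_mem_couplings ν Kernel.id κ₂, isCausal_of_ae_eq hae, isCausal_of_ae_eq ?_⟩
  rw [ae_map_iff measurable_swap.aemeasurable
    (measurableSet_eq_fun (by fun_prop) (by fun_prop))]
  exact hae.mono fun z hz => hz.symm

/-- The kernel is the conditional law of `x` given `S x`. It transports `S_*ρ` back to `ρ` along the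
graph of `S`, which need not be injective. -/
theorem exists_kernel_compProd_eq_map {ρ : Measure ℝ} [IsProbabilityMeasure ρ] {S : ℝ → ℝ}
    (hS : Measurable S) :
    ∃ κ : Kernel ℝ ℝ, IsMarkovKernel κ ∧ (ρ.map S).compProd κ = ρ.map fun x => (S x, x) := by
  have hm : Measurable fun x => (S x, x) := by fun_prop
  have := Measure.isProbabilityMeasure_map (μ := ρ) hm.aemeasurable
  refine ⟨(ρ.map fun x => (S x, x)).condKernel, inferInstance, ?_⟩
  have h : (ρ.map fun x => (S x, x)).fst = ρ.map S := by
    rw [Measure.fst, Measure.map_map measurable_fst hm]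
    rfl
  rw [← h]
  exact Measure.disintegrate _ _

theorem compProd_id_eq (ρ : Measure ℝ) [IsProbabilityMeasure ρ] :
    ρ.compProd Kernel.id = ρ.map fun x => (x, x) := by
  refine Measure.ext_of_lintegral _ fun f hf => ?_
  rw [Measure.lintegral_compProd hf, lintegral_map hf (by fun_prop)]
  simp only [Kernel.id_apply]
  refine lintegral_congr fun x => ?_
  rw [lintegral_dirac' _ (by fun_prop)]

theorem map_snd_map_graph {ρ : Measure ℝ} {S : ℝ → ℝ} (hS : Measurable S) :
    (ρ.map fun x => (S x, x)).map Prod.snd = ρ := by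
  rw [Measure.map_map measurable_snd (by fun_prop)]
  exact Measure.map_id

theorem lintegral_map_graph {ρ : Measure ℝ} {S : ℝ → ℝ} (hS : Measurable S) (p : ℝ) :
    ∫⁻ w, ENNReal.ofReal |w.1 - w.2| ^ p ∂ρ.map (fun x => (S x, x)) =
      ∫⁻ x, ENNReal.ofReal |S x - x| ^ p ∂ρ :=
  lintegral_map (Measurable.pow_const (by fun_prop) p) (by fun_prop)

variable {ν} {μ₁ μ₂ : Measure ℝ} [IsProbabilityMeasure μ₁] [IsProbabilityMeasure μ₂]
  {S₁ S₂ : ℝ → ℝ} {p : ℝ}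

/-- Transporting both marginals separately bounds the distance to the couplings. -/
theorem distToSet_wass_le (hp : 1 ≤ p) (hS₁ : Measurable S₁) (hS₂ : Measurable S₂)
    (h₁ : μ₁.map S₁ = ν.map Prod.fst) (h₂ : μ₂.map S₂ = ν.map Prod.snd) :
    distToSet (wass p) ν (couplings μ₁ μ₂) ≤
      (∫⁻ x, ENNReal.ofReal |S₁ x - x| ^ p ∂μ₁) ^ (1 / p) +
      (∫⁻ x, ENNReal.ofReal |S₂ x - x| ^ p ∂μ₂) ^ (1 / p) := by
  obtain ⟨κ₁, _, hκ₁⟩ := exists_kernel_compProd_eq_map (ρ := μ₁) hS₁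
  obtain ⟨κ₂, _, hκ₂⟩ := exists_kernel_compProd_eq_map (ρ := μ₂) hS₂
  rw [h₁] at hκ₁
  rw [h₂] at hκ₂
  have hmem := map_snd_glue_mem_couplings ν κ₁ κ₂ (μ₁ := μ₁) (μ₂ := μ₂)
    (by rw [hκ₁, map_snd_map_graph hS₁]) (by rw [hκ₂, map_snd_map_graph hS₂])
  have hcost := transportCost_glue_le ν κ₁ κ₂ hp
  rw [hκ₁, hκ₂, lintegral_map_graph hS₁, lintegral_map_graph hS₂] at hcost
  exact (iInf₂_le_of_le _ hmem (iInf₂_le _ (glue_mem_couplings ν κ₁ κ₂))).trans hcost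

/-- Transporting the second marginal with the first coordinate fixed bounds the adapted distance to
the couplings. -/
theorem distToSet_adaptedWass_le (hp : 1 ≤ p) (hS₂ : Measurable S₂)
    (h₁ : ν.map Prod.fst = μ₁) (h₂ : μ₂.map S₂ = ν.map Prod.snd) :
    distToSet (adaptedWass p) ν (couplings μ₁ μ₂) ≤
      (∫⁻ x, ENNReal.ofReal |S₂ x - x| ^ p ∂μ₂) ^ (1 / p) := by
  obtain ⟨κ₂, _, hκ₂⟩ := exists_kernel_compProd_eq_map (ρ := μ₂) hS₂
  rw [h₂] at hκ₂
  have hκ₁ := compProd_id_eq μ₁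
  rw [← h₁] at hκ₁
  have hmem := map_snd_glue_mem_couplings ν Kernel.id κ₂ (μ₁ := μ₁) (μ₂ := μ₂)
    (by rw [hκ₁, map_snd_map_graph measurable_id', h₁]) (by rw [hκ₂, map_snd_map_graph hS₂])
  have hcost := transportCost_glue_le ν Kernel.id κ₂ hp
  rw [hκ₁, hκ₂, lintegral_map_graph measurable_id', lintegral_map_graph hS₂] at hcost
  have hp0 : 0 < p := by linarith
  simp only [sub_self, abs_zero, ENNReal.ofReal_zero, ENNReal.zero_rpow_of_pos hp0, lintegral_zero,
    ENNReal.zero_rpow_of_pos (one_div_pos.2 hp0), zero_add] at hcost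
  exact (iInf₂_le_of_le _ hmem (iInf₂_le _ (glue_id_mem_bicausalCouplings ν κ₂))).trans hcost

end Glue

/-! ### Marginals of the displaced measure and the limsup bounds -/

theorem HasContDensityOn.absolutelyContinuous {ρ : Measure ℝ} {I : Set ℝ}
    (h : HasContDensityOn ρ I) : ρ ≪ volume := by
  obtain ⟨-, q, -, -, rfl⟩ := h
  exact withDensity_absolutelyContinuous _ _

theorem map_fst_displace {μ : Measure (ℝ × ℝ)} {Θ : ℝ × ℝ → ℝ × ℝ} (hΘ : Measurable Θ) (r : ℝ) :
    (displace μ (r • Θ)).map Prod.fst = μ.map fun x => x.1 + r * (Θ x).1 := by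
  exact Measure.map_map measurable_fst (measurable_id.add (hΘ.const_smul r))

theorem map_snd_displace {μ : Measure (ℝ × ℝ)} {Θ : ℝ × ℝ → ℝ × ℝ} (hΘ : Measurable Θ) (r : ℝ) :
    (displace μ (r • Θ)).map Prod.snd = μ.map fun x => x.2 + r * (Θ x).2 := by
  exact Measure.map_map measurable_snd (measurable_id.add (hΘ.const_smul r))

theorem limsup_div_le {f g : ℝ → ℝ≥0∞} {a : ℝ≥0∞} (hfg : ∀ r, f r ≤ g r)
    (hg : Tendsto (fun r => g r / ENNReal.ofReal r) (𝓝[>] 0) (𝓝 a)) :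
    limsup (fun r : ℝ => f r / ENNReal.ofReal r) (𝓝[>] 0) ≤ a := by
  rw [← hg.limsup_eq]
  exact limsup_le_limsup (Eventually.of_forall fun r => ENNReal.div_le_div_right (hfg r) _)

section Projection

variable {p : ℝ} {μ : Measure (ℝ × ℝ)} [IsProbabilityMeasure μ] {Θ : ℝ × ℝ → ℝ × ℝ} {B : ℝ}

theorem limsup_distToSet_wass_le (hp : 1 ≤ p) (hΘ : Measurable Θ) (hB : ∀ x, ‖Θ x‖ ≤ B)
    (h₁ : μ.map Prod.fst ≪ volume) (h₂ : μ.map Prod.snd ≪ volume) :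
    limsup (fun r : ℝ => distToSet (wass p) (displace μ (r • Θ))
      (couplings (μ.map Prod.fst) (μ.map Prod.snd)) / ENNReal.ofReal r) (𝓝[>] 0) ≤
      marginalNorm p μ Θ := by
  have hp0 : 0 < p := by linarith
  have hlim := (tendsto_cost_monotoneMap_div (μ := μ) hp0 measurable_fst hΘ.fst
    (fun x => (norm_fst_le (Θ x)).trans (hB x)) h₁).add
    (tendsto_cost_monotoneMap_div (μ := μ) hp0 measurable_snd hΘ.snd
    (fun x => (norm_snd_le (Θ x)).trans (hB x)) h₂)
  simp only [← ENNReal.add_div] at hlim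
  refine limsup_div_le (fun r => ?_) hlim
  have := Measure.isProbabilityMeasure_map (μ := μ) measurable_fst.aemeasurable
  have := Measure.isProbabilityMeasure_map (μ := μ) measurable_snd.aemeasurable
  have := nullSingletonClass_of_absolutelyContinuous h₁
  have := nullSingletonClass_of_absolutelyContinuous h₂
  have : IsProbabilityMeasure (displace μ (r • Θ)) :=
    Measure.isProbabilityMeasure_map (measurable_id.add (hΘ.const_smul r)).aemeasurable
  have := Measure.isProbabilityMeasure_map (μ := displace μ (r • Θ)) measurable_fst.aemeasurable
  have := Measure.isProbabilityMeasure_map (μ := displace μ (r • Θ)) measurable_snd.aemeasurable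
  rw [← map_fst_displace hΘ, ← map_snd_displace hΘ]
  exact distToSet_wass_le hp (measurable_monotoneMap _ _) (measurable_monotoneMap _ _)
    (map_monotoneMap _) (map_monotoneMap _)

theorem limsup_distToSet_adaptedWass_le (hp : 1 ≤ p) (hΘ : Measurable Θ) (hB : ∀ x, ‖Θ x‖ ≤ B)
    (hΘ₁ : ∀ x, (Θ x).1 = 0) (h₂ : μ.map Prod.snd ≪ volume) :
    limsup (fun r : ℝ => distToSet (adaptedWass p) (displace μ (r • Θ))
      (couplings (μ.map Prod.fst) (μ.map Prod.snd)) / ENNReal.ofReal r) (𝓝[>] 0) ≤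
      marginalNorm p μ Θ := by
  have hlim := tendsto_cost_monotoneMap_div (μ := μ) (by linarith) measurable_snd hΘ.snd
    (fun x => (norm_snd_le (Θ x)).trans (hB x)) h₂
  -- Only the second coordinate is transported; the first term of `marginalNorm` is added for free.
  refine (limsup_div_le (fun r => ?_) hlim).trans le_add_self
  have := Measure.isProbabilityMeasure_map (μ := μ) measurable_fst.aemeasurable
  have := Measure.isProbabilityMeasure_map (μ := μ) measurable_snd.aemeasurable
  have := nullSingletonClass_of_absolutelyContinuous h₂
  have : IsProbabilityMeasure (displace μ (r • Θ)) :=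
    Measure.isProbabilityMeasure_map (measurable_id.add (hΘ.const_smul r)).aemeasurable
  have := Measure.isProbabilityMeasure_map (μ := displace μ (r • Θ)) measurable_snd.aemeasurable
  rw [← map_snd_displace hΘ]
  refine distToSet_adaptedWass_le hp (measurable_monotoneMap _ _) ?_ (map_monotoneMap _)
  rw [map_fst_displace hΘ]
  simp only [hΘ₁, mul_zero, add_zero]

end Projection

end CouplingProj

theorem mainTheorem6 (p : ℝ) (hp : 1 < p) (μ : Measure (ℝ × ℝ)) [IsProbabilityMeasure μ]
    (hμ : CouplingProj.HasFiniteMoment p μ) (I₁ I₂ : Set ℝ) :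
    (CouplingProj.AssumptionWass μ I₁ I₂ →
      ∃ C : ℝ, 0 < C ∧ ∀ Θ : ℝ × ℝ → ℝ × ℝ, ContDiff ℝ 2 Θ → HasCompactSupport Θ →
        (∃ M₁ M₂ : Set ℝ, M₁ ⊂ I₁ ∧ M₂ ⊂ I₂ ∧ tsupport Θ ⊆ M₁ ×ˢ M₂) →
        limsup (fun r : ℝ =>
            CouplingProj.distToSet (CouplingProj.wass p) (CouplingProj.displace μ (r • Θ))
              (CouplingProj.couplings (μ.map Prod.fst) (μ.map Prod.snd)) / ENNReal.ofReal r)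
          (𝓝[>] 0) ≤ ENNReal.ofReal C * CouplingProj.marginalNorm p μ Θ) ∧
    (CouplingProj.AssumptionAdapted μ I₂ →
      ∃ C : ℝ, 0 < C ∧ ∀ Θ : ℝ × ℝ → ℝ × ℝ, ContDiff ℝ 2 Θ → HasCompactSupport Θ →
        (∀ x, (Θ x).1 = 0) →
        (∃ M₂ : Set ℝ, M₂ ⊂ I₂ ∧ tsupport Θ ⊆ Set.univ ×ˢ M₂) →
        limsup (fun r : ℝ =>
            CouplingProj.distToSet (CouplingProj.adaptedWass p) (CouplingProj.displace μ (r • Θ))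
              (CouplingProj.couplings (μ.map Prod.fst) (μ.map Prod.snd)) / ENNReal.ofReal r)
          (𝓝[>] 0) ≤ ENNReal.ofReal C * CouplingProj.marginalNorm p μ Θ) := by
  -- The constant `1` works because the glued cost is at most the sum of costs whose rates are
  -- exactly the two norms.
  refine ⟨fun h => ⟨1, one_pos, fun Θ hΘ hsupp _ => ?_⟩,
    fun h => ⟨1, one_pos, fun Θ hΘ hsupp hΘ₁ _ => ?_⟩⟩ <;>
  obtain ⟨B, hB⟩ := hsupp.exists_bound_of_continuous hΘ.continuous <;>
  rw [ENNReal.ofReal_one, one_mul]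
  · exact CouplingProj.limsup_distToSet_wass_le hp.le hΘ.continuous.measurable hB
      h.marginal₁.absolutelyContinuous h.marginal₂.absolutelyContinuous
  · exact CouplingProj.limsup_distToSet_adaptedWass_le hp.le hΘ.continuous.measurable hB hΘ₁
      h.marginal₂.absolutelyContinuous
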